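/- Let $\mathbb X,\mathbb Y$ be finite alphabets, $p_0$ a PMF on $\mathbb X$ and $p_{\hat X|X}$ a conditional PMF on $\mathbb X$ given $\mathbb X$. For $L$ agents and blocklength $n$, let $(X^n,\hat X_1^n,\dots,\hat X_L^n)\sim\prod_{i=1}^n p_0(x_i)\prod_{l=1}^L p_{\hat X|X}(\hat x_{l,i}|x_i)$. A code of rate $R$ per agent consists of encoders $i_l:\mathbb X^n\to\{1,\dots,\lfloor 2^{nR}\rfloor\}$, $l=1,\dots,L$, and a decoder $y^n:\{1,\dots,\lfloor 2^{nR}\rfloor\}^L\to\mathbb Y^n$; it produces $Y^n=y^n(i_1(\hat X_1^n),\dots,i_L(\hat X_L^n))$. Let $P_{X^n,Y^n}(x,y)=\frac1n\sum_{i=1}^n\mathbf 1\{(X_i,Y_i)=(x,y)\}$ be the joint type and $\|p-q\|_{TV}=\frac12\sum|p-q|$. A pair $(R,p_{Y|X})$, with $p_{Y|X}$ a conditional PMF on $\mathbb Y$ given $\mathbb X$, is achievable (for perfect empirical coordination with $L\to\infty$) if there is a family of codes of rate $R$ per agent, one for each pair $(n,L)$, such that $\|P_{X^n,Y^n}-p_0p_{Y|X}\|_{TV}\to0$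 in probability, where the limits in $L$ and in $n$ are taken one after the other: for every $\varepsilon>0$, $$\lim_{n\to\infty}\limsup_{L\to\infty}\Pr\big[\|P_{X^n,Y^n}-p_0p_{Y|X}\|_{TV}>\varepsilon\big]=0 ,$$ and for the same codes also $$\lim_{L\to\infty}\limsup_{n\to\infty}\Pr\big[\|P_{X^n,Y^n}-p_0p_{Y|X}\|_{TV}>\varepsilon\big]=0 .$$ The coordination capacity region $C^P_{p_{X,\hat X}}$ is the closure (in $\mathbb R\times\mathbb R^{\mathbb X\times\mathbb Y}$) of the set of achievable pairs $(R,p_{Y|X})$. Theorem. For every such $p_0$ and $p_{\hat X|X}$, $$C^P_{p_{X,\hat X}}\supseteq \mathbf{Cl}\big\{(R_{\rm ag},p_{Y|X}):\ X-\hat X-Y,\ R_{\rm ag}\ge I(\hat X;Y|X)\big\}.$$ Here a pair belongs to the set on the right if there is a joint PMF of $(X,\hat X,Y)$ with marginals $p_0(x)p_{\hat X|X}(\hat x|x)$ and $p_0(x)p_{Y|X}(y|x)$ for which $X-\hat X-Y$ is a Markov chain and $I(\hat X;Y|X)\le R_{\rm ag}$, with $I$ in bits. -/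

import Mathlib

namespace Coordination

/-- The joint type (empirical probability mass function) of a pair of sequences of length `n`. -/
noncomputable def jointType {X Y : Type*} [DecidableEq X] [DecidableEq Y] {n : ℕ}
    (x : Fin n → X) (y : Fin n → Y) : X × Y → ℝ :=
  fun ab => (1 / (n : ℝ)) * ∑ i : Fin n, if (x i, y i) = ab then (1 : ℝ) else 0

/-- Total variation between two probability mass functions on a finite alphabet. -/
noncomputable def tvDist {A : Type*} [Fintype A] (p q : A → ℝ) : ℝ :=
  (1 / 2) * ∑ a, |p a - q a|

/-- `q x y` is a conditional probability mass function of `y` given `x`. -/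
def IsCondPMF {A B : Type*} [Fintype B] (q : A → B → ℝ) : Prop :=
  ∀ a, q a ∈ stdSimplex ℝ B

/-- The number of messages at rate `R` (in bits per symbol) and blocklength `n`,
the integer part of `2 ^ (n R)`. -/
noncomputable def numMessages (n : ℕ) (R : ℝ) : ℕ :=
  ⌊(2 : ℝ) ^ ((n : ℝ) * R)⌋₊

/-- A `(2^{n R_1}, …, 2^{n R_L}, n)` coordination code: `L` encoders, each of which sees only
its own length-`n` observation, and one decoder, which sees all the messages. -/
structure Code (X Y : Type*) (L n : ℕ) (R : Fin L → ℝ) where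
  enc : (l : Fin L) → (Fin n → X) → Fin (numMessages n (R l))
  dec : ((l : Fin L) → Fin (numMessages n (R l))) → (Fin n → Y)

/-- The action sequence `Y^n` produced from the observations of the `L` agents. -/
def Code.output {X Y : Type*} {L n : ℕ} {R : Fin L → ℝ} (c : Code X Y L n R)
    (xh : Fin L → Fin n → X) : Fin n → Y :=
  c.dec fun l => c.enc l (xh l)

/-- The probability of `(x^n, x̂_1^n, …, x̂_L^n)`: i.i.d. in time, and at each time the `L`
observations are conditionally independent given the source symbol, with law `W (x i)`. -/
noncomputable def sourceProb {X : Type*} (p0 : X → ℝ) (W : X → X → ℝ) {L n : ℕ}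
    (x : Fin n → X) (xh : Fin L → Fin n → X) : ℝ :=
  ∏ i : Fin n, (p0 (x i) * ∏ l : Fin L, W (x i) (xh l i))

/-- The probability that the joint type of `(X^n, Y^n)` is at total variation more than `ε`
from the target `p0(x) q(y|x)`. -/
noncomputable def deviationProb {X Y : Type*} [Fintype X] [DecidableEq X] [Fintype Y]
    [DecidableEq Y] (p0 : X → ℝ) (W : X → X → ℝ) (q : X → Y → ℝ) {L n : ℕ} {R : Fin L → ℝ}
    (c : Code X Y L n R) (ε : ℝ) : ℝ :=
  ∑ x : Fin n → X, ∑ xh : Fin L → Fin n → X,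
    if ε < tvDist (jointType x (c.output xh)) (fun ab => p0 ab.1 * q ab.1 ab.2)
      then sourceProb p0 W x xh else 0

/-- `p0(x) q(y|x)` is achievable for perfect empirical coordination with an unbounded number
of agents at the rate `R` per agent. The convergence to `0` in probability is required in both
senses of taking the limits one after the other, for one family of codes:
`lim_n limsup_L Pr[TV > ε] = 0` (for each fixed large `n`, let `L → ∞`; then `n → ∞`) and
`lim_L limsup_n Pr[TV > ε] = 0` (first fix a large `L`, then let `n → ∞`). -/
def Achievable {X Y : Type*} [Fintype X] [DecidableEq X] [Fintype Y] [DecidableEq Y]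
    (p0 : X → ℝ) (W : X → X → ℝ) (R : ℝ) (q : X → Y → ℝ) : Prop :=
  ∃ c : (n L : ℕ) → Code X Y L n (fun _ => R),
    (∀ ε > 0, ∀ δ > 0, ∀ᶠ n in Filter.atTop, ∀ᶠ L in Filter.atTop,
      deviationProb p0 W q (c n L) ε < δ) ∧
    (∀ ε > 0, ∀ δ > 0, ∀ᶠ L in Filter.atTop, ∀ᶠ n in Filter.atTop,
      deviationProb p0 W q (c n L) ε < δ)

/-- The coordination capacity region for `L → ∞`: the closure of the set of achievable pairs
`(R, p_{Y|X})`. -/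
def capacityRegion {X : Type*} (Y : Type*) [Fintype X] [DecidableEq X] [Fintype Y]
    [DecidableEq Y] (p0 : X → ℝ) (W : X → X → ℝ) : Set (ℝ × (X → Y → ℝ)) :=
  closure {a | IsCondPMF a.2 ∧ Achievable p0 W a.1 a.2}

/-- The Markov chain `A - B - C` for a joint probability mass function `p a b c`:
`p(a,b,c) p(b) = p(a,b) p(b,c)`. -/
def IsMarkovChain {A B C : Type*} [Fintype A] [Fintype C] (p : A → B → C → ℝ) : Prop :=
  ∀ a b c, p a b c * (∑ a', ∑ c', p a' b c') = (∑ c', p a b c') * (∑ a', p a' b c)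

/-- Conditional mutual information `I(B;C|A)` in bits of a joint probability mass function
`p a b c`. -/
noncomputable def condMutualInfo {A B C : Type*} [Fintype A] [Fintype B] [Fintype C]
    (p : A → B → C → ℝ) : ℝ :=
  ∑ a, ∑ b, ∑ c, p a b c *
    Real.logb 2 ((p a b c * ∑ b', ∑ c', p a b' c') / ((∑ c', p a b c') * ∑ b', p a b' c))

/-- `p x x̂ y` is a joint probability mass function of `(X, X̂, Y)` with `(X, X̂)`-law
`p0(x) W(x̂|x)` and `(X, Y)`-law `p0(x) q(y|x)`. -/
def IsJointPMF {X Y : Type*} [Fintype X] [Fintype Y] (p0 : X → ℝ) (W : X → X → ℝ)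
    (q : X → Y → ℝ) (p : X → X → Y → ℝ) : Prop :=
  (∀ x xh y, 0 ≤ p x xh y) ∧
  (∀ x xh, ∑ y, p x xh y = p0 x * W x xh) ∧
  (∀ x y, ∑ xh, p x xh y = p0 x * q x y)

/-- The pairs `(R, p_{Y|X})` with `X - X̂ - Y` and `R ≥ I(X̂;Y|X)`. -/
def innerRegion {X : Type*} (Y : Type*) [Fintype X] [Fintype Y]
    (p0 : X → ℝ) (W : X → X → ℝ) : Set (ℝ × (X → Y → ℝ)) :=
  {a | IsCondPMF a.2 ∧ ∃ p : X → X → Y → ℝ,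
    IsJointPMF p0 W a.2 p ∧ IsMarkovChain p ∧ condMutualInfo p ≤ a.1}

end Coordination

/-!
With an unbounded number of agents, every positive rate per agent suffices. At rate `R > 0` an
agent can forward a fixed fraction `1 / s` of its `n` symbols uncoded, so `2 * s` agents together
can forward one noisy symbol `X̂ i` for every time `i`. The decoder applies to it a map
`f i : X → Y` fixed in advance.

The Markov chain `X - X̂ - Y` provides a channel `v` from `X̂` to `Y`. If the values `f i b` are
drawn independently with law `v b`, the pairs `(X i, Y i)` become i.i.d. with the target law, and
the mean squared distance of their joint type from the target is at most `1 / n`. Some choice of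
the maps does as well as the average, and Chebyshev's inequality bounds its deviation probability.
The bound depends on `n` alone once `L ≥ 2 * s`, so it serves both orders of the limits.
Nonnegative rates are limits of positive ones, and `I(X̂;Y|X) ≥ 0` by Gibbs' inequality.
-/

open Filter Topology

namespace Coordination

section ProductWeights

variable {ι R : Type*} [Fintype ι] [DecidableEq ι] [CommSemiring R]
  {A : ι → Type*} [∀ i, Fintype (A i)]

theorem sum_prod_mul_prod {h : ∀ i, A i → R} (hh : ∀ i, ∑ a, h i a = 1) (φ : ∀ i, A i → R)
    (s : Finset ι) :
    ∑ z : ∀ i, A i, (∏ i, h i (z i)) * ∏ i ∈ s, φ i (z i) = ∏ i ∈ s, ∑ a, h i a * φ i a := by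
  calc ∑ z : ∀ i, A i, (∏ i, h i (z i)) * ∏ i ∈ s, φ i (z i)
      = ∑ z : ∀ i, A i, ∏ i, h i (z i) * (if i ∈ s then φ i (z i) else 1) := by
        simp_rw [Finset.prod_mul_distrib, Finset.prod_ite_mem, Finset.univ_inter]
    _ = ∏ i, ∑ a, h i a * (if i ∈ s then φ i a else 1) :=
        (Fintype.prod_sum fun i a => h i a * if i ∈ s then φ i a else 1).symm
    _ = ∏ i, if i ∈ s then ∑ a, h i a * φ i a else 1 :=
        Finset.prod_congr rfl fun i _ => by split_ifs <;> simp [hh]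
    _ = ∏ i ∈ s, ∑ a, h i a * φ i a := by simp [Finset.prod_ite_mem]

theorem sum_prod_mul_apply {h : ∀ i, A i → R} (hh : ∀ i, ∑ a, h i a = 1) (i : ι)
    (φ : A i → R) :
    ∑ z : ∀ i, A i, (∏ i, h i (z i)) * φ (z i) = ∑ a, h i a * φ a := by
  have := sum_prod_mul_prod hh (Function.update (fun _ _ => 1) i φ) {i}
  simpa using this

theorem sum_prod_mul_sq_sum {S : Type*} [CommRing S] {h : ∀ i, A i → S}
    (hh : ∀ i, ∑ a, h i a = 1) {g : ∀ i, A i → S} (hg : ∀ i, ∑ a, h i a * g i a = 0) :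
    ∑ z : ∀ i, A i, (∏ i, h i (z i)) * (∑ i, g i (z i)) ^ 2 = ∑ i, ∑ a, h i a * g i a ^ 2 := by
  have cross : ∀ i j, i ≠ j →
      ∑ z : ∀ i, A i, (∏ k, h k (z k)) * (g i (z i) * g j (z j)) = 0 := fun i j hij => by
    simpa [Finset.prod_pair hij, hg] using sum_prod_mul_prod hh g {i, j}
  simp_rw [sq (∑ i, g i _), Finset.sum_mul_sum, Finset.mul_sum]
  rw [Finset.sum_comm]
  refine Finset.sum_congr rfl fun i _ => ?_
  rw [Finset.sum_comm, Finset.sum_eq_single i (fun j _ hj => cross i j hj.symm) (by simp)]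
  simpa only [sq] using sum_prod_mul_apply hh i fun a => g i a * g i a

theorem sum_prod_prod_mul_comp_eval {κ B : Type*} [Fintype κ] [DecidableEq κ] [Fintype B]
    {h : ι → κ → B → R} (hh : ∀ i k, ∑ b, h i k b = 1) (c : ι → κ) (Φ : (ι → B) → R) :
    ∑ g : ι → κ → B, (∏ i, ∏ k, h i k (g i k)) * Φ (fun i => g i (c i))
      = ∑ z : ι → B, (∏ i, h i (c i) (z i)) * Φ z := by
  classical
  have marginal : ∀ i b, ∑ g : κ → B with g (c i) = b, ∏ k, h i k (g k) = h i (c i) b := by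
    intro i b
    have := sum_prod_mul_apply (hh i) (c i) fun b' => if b' = b then 1 else 0
    simpa [Finset.sum_filter] using this
  rw [← Finset.sum_fiberwise Finset.univ fun (g : ι → κ → B) i => g i (c i)]
  refine Finset.sum_congr rfl fun z _ => ?_
  have fiber : (Finset.univ.filter fun g : ι → κ → B => (fun i => g i (c i)) = z)
      = Fintype.piFinset fun i => Finset.univ.filter fun g : κ → B => g (c i) = z i := by
    ext g
    simp [funext_iff]
  calc ∑ g : ι → κ → B with (fun i => g i (c i)) = z,
        (∏ i, ∏ k, h i k (g i k)) * Φ (fun i => g i (c i))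
      = ∑ g : ι → κ → B with (fun i => g i (c i)) = z, (∏ i, ∏ k, h i k (g i k)) * Φ z :=
        Finset.sum_congr rfl fun g hg => by rw [(Finset.mem_filter.1 hg).2]
    _ = (∏ i, ∑ g : κ → B with g (c i) = z i, ∏ k, h i k (g k)) * Φ z := by
        rw [← Finset.sum_mul, fiber, Finset.prod_univ_sum]
    _ = (∏ i, h i (c i) (z i)) * Φ z := by simp_rw [marginal]

theorem prod_mem_stdSimplex {h : ∀ i, A i → ℝ} (hh : ∀ i, h i ∈ stdSimplex ℝ (A i)) :
    (fun z : ∀ i, A i => ∏ i, h i (z i)) ∈ stdSimplex ℝ (∀ i, A i) := by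
  refine ⟨fun z => Finset.prod_nonneg fun i _ => (hh i).1 (z i), ?_⟩
  rw [← Fintype.prod_sum]
  exact Finset.prod_eq_one fun i _ => (hh i).2

end ProductWeights

section Simplex

variable {A : Type*} [Fintype A] {p : A → ℝ}

theorem nonempty_of_mem_stdSimplex (hp : p ∈ stdSimplex ℝ A) : Nonempty A := by
  by_contra hA
  rw [not_nonempty_iff] at hA
  simpa using hp.2

theorem exists_le_sum_mul_of_mem_stdSimplex (hp : p ∈ stdSimplex ℝ A) (G : A → ℝ) :
    ∃ a, G a ≤ ∑ a, p a * G a := by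
  obtain ⟨a, -, ha⟩ := (concaveOn_id (𝕜 := ℝ) convex_univ).exists_le_of_centerMass
    (t := Finset.univ) (p := G) (fun a _ => hp.1 a) (hp.2 ▸ one_pos) fun _ _ => Set.mem_univ _
  exact ⟨a, by simpa [Finset.centerMass_eq_of_sum_1 _ _ hp.2] using ha⟩

end Simplex

section EmpiricalDistribution

/-- The empirical distribution of a sequence; the joint type is that of a sequence of pairs.
It is identically zero for the empty sequence. -/
noncomputable def empiricalDist {A : Type*} [DecidableEq A] {n : ℕ} (z : Fin n → A) : A → ℝ :=
  fun a => (1 / (n : ℝ)) * ∑ i : Fin n, if z i = a then (1 : ℝ) else 0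

/-- The squared Euclidean distance, which dominates the total variation distance and whose mean
is computable from variances. -/
def sqDist {A : Type*} [Fintype A] (p q : A → ℝ) : ℝ :=
  ∑ a, (p a - q a) ^ 2

variable {A : Type*} [Fintype A]

theorem sqDist_nonneg (p q : A → ℝ) : 0 ≤ sqDist p q :=
  Finset.sum_nonneg fun _ _ => sq_nonneg _

theorem sq_tvDist_le (p q : A → ℝ) : tvDist p q ^ 2 ≤ Fintype.card A / 4 * sqDist p q := by
  have cauchySchwarz : (∑ a, |p a - q a|) ^ 2 ≤ Fintype.card A * sqDist p q := by
    simpa [sqDist] using sq_sum_le_card_mul_sum_sq (s := Finset.univ) (f := fun a => |p a - q a|)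
  rw [tvDist, mul_pow]
  linarith

variable [DecidableEq A] {p : A → ℝ}

theorem sum_mul_indicator_sub (hp : ∑ a, p a = 1) (a : A) :
    ∑ b, p b * ((if b = a then 1 else 0) - p a) = 0 := by
  simp [mul_sub, Finset.sum_sub_distrib, ← Finset.sum_mul, hp]

theorem sum_mul_indicator_sub_sq (hp : ∑ a, p a = 1) (a : A) :
    ∑ b, p b * ((if b = a then 1 else 0) - p a) ^ 2 = p a * (1 - p a) := by
  have expand : ∀ b, p b * ((if b = a then 1 else 0) - p a) ^ 2
      = (if b = a then p b * (1 - 2 * p a) else 0) + p b * p a ^ 2 := fun b => by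
    split_ifs <;> ring
  simp_rw [expand, Finset.sum_add_distrib, ← Finset.sum_mul, hp]
  simp only [Finset.sum_ite_eq', Finset.mem_univ, if_true]
  ring

theorem sum_prod_mul_empiricalDist_sub_sq (hp : ∑ a, p a = 1) {n : ℕ} (hn : n ≠ 0) (a : A) :
    ∑ z : Fin n → A, (∏ i, p (z i)) * (empiricalDist z a - p a) ^ 2 = p a * (1 - p a) / n := by
  have hn' : (n : ℝ) ≠ 0 := Nat.cast_ne_zero.2 hn
  have centred : ∀ z : Fin n → A, (empiricalDist z a - p a) ^ 2
      = (1 / (n : ℝ)) ^ 2 * (∑ i, ((if z i = a then 1 else 0) - p a)) ^ 2 := fun z => by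
    rw [← mul_pow, empiricalDist, Finset.sum_sub_distrib, mul_sub]
    simp [hn']
  calc ∑ z : Fin n → A, (∏ i, p (z i)) * (empiricalDist z a - p a) ^ 2
      = (1 / (n : ℝ)) ^ 2 * ∑ z : Fin n → A,
          (∏ i, p (z i)) * (∑ i, ((if z i = a then 1 else 0) - p a)) ^ 2 := by
        simp_rw [centred, Finset.mul_sum, mul_left_comm]
    _ = (1 / (n : ℝ)) ^ 2 * ∑ _i : Fin n, p a * (1 - p a) := by
        rw [sum_prod_mul_sq_sum (fun _ => hp) fun _ => sum_mul_indicator_sub hp a]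
        simp_rw [sum_mul_indicator_sub_sq hp a]
    _ = p a * (1 - p a) / n := by
        simp only [Finset.sum_const, Finset.card_univ, Fintype.card_fin, nsmul_eq_mul]
        field_simp

theorem sum_prod_mul_sqDist_empiricalDist_le (hp : ∑ a, p a = 1) {n : ℕ} (hn : n ≠ 0) :
    ∑ z : Fin n → A, (∏ i, p (z i)) * sqDist (empiricalDist z) p ≤ 1 / n := by
  calc ∑ z : Fin n → A, (∏ i, p (z i)) * sqDist (empiricalDist z) p
      = ∑ a, p a * (1 - p a) / n := by
        simp_rw [sqDist, Finset.mul_sum]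
        rw [Finset.sum_comm]
        simp_rw [sum_prod_mul_empiricalDist_sub_sq hp hn]
    _ ≤ ∑ a, p a / n := Finset.sum_le_sum fun a _ => by
        gcongr
        nlinarith [sq_nonneg (p a)]
    _ = 1 / n := by rw [← Finset.sum_div, hp]

end EmpiricalDistribution

section Information

theorem sum_mul_logb_div_nonneg {A : Type*} [Fintype A] {b : ℝ} (hb : 1 < b) {p q : A → ℝ}
    (hp : ∀ a, 0 ≤ p a) (hq : ∀ a, 0 ≤ q a) (hpq : ∀ a, q a = 0 → p a = 0)
    (hsum : ∑ a, q a ≤ ∑ a, p a) : 0 ≤ ∑ a, p a * Real.logb b (p a / q a) := by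
  have pointwise : ∀ a, p a - q a ≤ p a * Real.log (p a / q a) := fun a => by
    rcases eq_or_ne (q a) 0 with h0 | h0
    · simp [h0, hpq a h0]
    · have h := mul_nonneg (hq a) (InformationTheory.klFun_nonneg (div_nonneg (hp a) (hq a)))
      rw [InformationTheory.klFun_apply, mul_sub, mul_add, ← mul_assoc, mul_div_cancel₀ _ h0] at h
      linarith
  simp_rw [Real.logb, ← mul_div_assoc, ← Finset.sum_div]
  refine div_nonneg ?_ (Real.log_pos hb).le
  calc 0 ≤ ∑ a, (p a - q a) := by rw [Finset.sum_sub_distrib]; exact sub_nonneg.2 hsum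
    _ ≤ ∑ a, p a * Real.log (p a / q a) := Finset.sum_le_sum fun a _ => pointwise a

variable {A B C : Type*} [Fintype A] [Fintype C] {p : A → B → C → ℝ}

theorem condMutualInfo_nonneg [Fintype B] (hp : ∀ a b c, 0 ≤ p a b c) : 0 ≤ condMutualInfo p := by
  refine Finset.sum_nonneg fun a _ => ?_
  set s := ∑ b, ∑ c, p a b c with hs
  set u : B → ℝ := fun b => ∑ c, p a b c
  set v : C → ℝ := fun c => ∑ b, p a b c
  have hu : ∀ b, 0 ≤ u b := fun b => Finset.sum_nonneg fun c _ => hp a b c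
  have hv : ∀ c, 0 ≤ v c := fun c => Finset.sum_nonneg fun b _ => hp a b c
  have hpu : ∀ b c, p a b c ≤ u b := fun b c =>
    Finset.single_le_sum (fun c _ => hp a b c) (Finset.mem_univ c)
  have hpv : ∀ b c, p a b c ≤ v c := fun b c =>
    Finset.single_le_sum (f := fun b => p a b c) (fun b _ => hp a b c) (Finset.mem_univ b)
  have hus : ∀ b, u b ≤ s := fun b => Finset.single_le_sum (fun b _ => hu b) (Finset.mem_univ b)
  have hvs : ∑ c, v c = s := by rw [hs, Finset.sum_comm]
  have gibbs := sum_mul_logb_div_nonneg one_lt_two (p := fun bc : B × C => p a bc.1 bc.2)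
    (q := fun bc => u bc.1 * v bc.2 / s) (fun bc => hp a bc.1 bc.2)
    (fun bc => div_nonneg (mul_nonneg (hu _) (hv _)) ((hu bc.1).trans (hus _)))
    (fun ⟨b, c⟩ h => ?_) ?_
  · simpa only [Fintype.sum_prod_type, div_div_eq_mul_div] using gibbs
  · refine le_antisymm ?_ (hp a b c)
    rcases div_eq_zero_iff.1 h with h | h
    · rcases mul_eq_zero.1 h with h | h
      · exact (hpu b c).trans_eq h
      · exact (hpv b c).trans_eq h
    · exact ((hpu b c).trans (hus b)).trans_eq h
  · simp_rw [Fintype.sum_prod_type, ← Finset.sum_div, ← Finset.mul_sum, hvs, ← Finset.sum_mul]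
    exact (mul_self_div_self s).le

theorem IsMarkovChain.exists_channel [Nonempty C] (hM : IsMarkovChain p)
    (hp : ∀ a b c, 0 ≤ p a b c) :
    ∃ v : B → C → ℝ, IsCondPMF v ∧ ∀ a b c, p a b c = (∑ c', p a b c') * v b c := by
  classical
  set s : B → ℝ := fun b => ∑ a, ∑ c, p a b c
  have hs : ∀ b, 0 ≤ s b := fun b =>
    Finset.sum_nonneg fun a _ => Finset.sum_nonneg fun c _ => hp a b c
  refine ⟨fun b => if s b = 0 then Pi.single (Classical.arbitrary C) 1
    else fun c => (∑ a, p a b c) / s b, fun b => ?_, fun a b c => ?_⟩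
  · dsimp only
    split_ifs with hb
    · exact single_mem_stdSimplex ℝ _
    · refine ⟨fun c => div_nonneg (Finset.sum_nonneg fun a _ => hp a b c) (hs b), ?_⟩
      rw [← Finset.sum_div, Finset.sum_comm]
      exact div_self hb
  · by_cases hb : s b = 0
    · have hab : ∑ c', p a b c' = 0 := (Finset.sum_eq_zero_iff_of_nonneg fun a _ =>
        Finset.sum_nonneg fun c _ => hp a b c).1 hb a (Finset.mem_univ a)
      rw [hab, zero_mul]
      exact (Finset.sum_eq_zero_iff_of_nonneg fun c _ => hp a b c).1 hab c (Finset.mem_univ c)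
    · simp only [hb, if_false]
      rw [← mul_div_assoc, eq_div_iff hb]
      exact hM a b c

end Information

section Relay

variable {X Y : Type*} [Fintype X] [Fintype Y]

/-- The joint law `p0(x) q(y|x)` of a source symbol and an action, the target of coordination. -/
def jointLaw (p0 : X → ℝ) (q : X → Y → ℝ) : X × Y → ℝ :=
  fun ab => p0 ab.1 * q ab.1 ab.2

/-- The mean squared distance of the joint type from the target when the actions are chosen
from all the observations by `g`. -/
noncomputable def meanSqDist [DecidableEq X] [DecidableEq Y] (p0 : X → ℝ) (W : X → X → ℝ)
    (q : X → Y → ℝ) {L n : ℕ} (g : (Fin L → Fin n → X) → Fin n → Y) : ℝ :=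
  ∑ x : Fin n → X, ∑ xh : Fin L → Fin n → X,
    sourceProb p0 W x xh * sqDist (jointType x (g xh)) (jointLaw p0 q)

variable {p0 : X → ℝ} {W : X → X → ℝ} {q v : X → Y → ℝ} {L n : ℕ}

theorem sum_jointLaw (hp0 : ∑ x, p0 x = 1) (hW : ∀ x, ∑ b, W x b = 1)
    (hv : ∀ b, ∑ y, v b y = 1) (hvq : ∀ x y, ∑ b, p0 x * W x b * v b y = p0 x * q x y) :
    ∑ ab, jointLaw p0 q ab = 1 := by
  simp_rw [Fintype.sum_prod_type, jointLaw, ← hvq]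
  calc ∑ x, ∑ y, ∑ b, p0 x * W x b * v b y
      = ∑ x, ∑ b, ∑ y, p0 x * W x b * v b y := Finset.sum_congr rfl fun x _ => Finset.sum_comm
    _ = 1 := by simp_rw [← Finset.mul_sum, hv, mul_one, ← Finset.mul_sum, hW, mul_one, hp0]

theorem sum_sourceProb_mul_comp_eval (hW : ∀ x, ∑ b, W x b = 1) (x : Fin n → X)
    (k : Fin n → Fin L) (Φ : (Fin n → X) → ℝ) :
    ∑ xh : Fin L → Fin n → X, sourceProb p0 W x xh * Φ (fun i => xh (k i) i)
      = ∑ b : Fin n → X, (∏ i, p0 (x i) * W (x i) (b i)) * Φ b := by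
  calc ∑ xh : Fin L → Fin n → X, sourceProb p0 W x xh * Φ (fun i => xh (k i) i)
      = ∑ g : Fin n → Fin L → X, (∏ i, p0 (x i) * ∏ l, W (x i) (g i l)) *
          Φ (fun i => g i (k i)) :=
        Fintype.sum_equiv (Equiv.piComm fun _ _ => X) _ _ fun _ => rfl
    _ = (∏ i, p0 (x i)) * ∑ g : Fin n → Fin L → X, (∏ i, ∏ l, W (x i) (g i l)) *
          Φ (fun i => g i (k i)) := by
        simp_rw [Finset.prod_mul_distrib, mul_assoc, Finset.mul_sum]
    _ = ∑ b : Fin n → X, (∏ i, p0 (x i) * W (x i) (b i)) * Φ b := by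
        rw [sum_prod_prod_mul_comp_eval fun i _ => hW (x i)]
        simp_rw [Finset.prod_mul_distrib, mul_assoc, Finset.mul_sum]

variable [DecidableEq X]

theorem sum_prod_mul_sum_sourceProb_mul (hW : ∀ x, ∑ b, W x b = 1) (hv : ∀ b, ∑ y, v b y = 1)
    (hvq : ∀ x y, ∑ b, p0 x * W x b * v b y = p0 x * q x y) (x : Fin n → X)
    (k : Fin n → Fin L) (Φ : (Fin n → Y) → ℝ) :
    ∑ f : Fin n → X → Y, (∏ i, ∏ b, v b (f i b)) *
        ∑ xh : Fin L → Fin n → X, sourceProb p0 W x xh * Φ (fun i => f i (xh (k i) i))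
      = ∑ y : Fin n → Y, (∏ i, jointLaw p0 q (x i, y i)) * Φ y := by
  calc ∑ f : Fin n → X → Y, (∏ i, ∏ b, v b (f i b)) *
        ∑ xh : Fin L → Fin n → X, sourceProb p0 W x xh * Φ (fun i => f i (xh (k i) i))
      = ∑ b : Fin n → X, (∏ i, p0 (x i) * W (x i) (b i)) *
          ∑ f : Fin n → X → Y, (∏ i, ∏ b, v b (f i b)) * Φ (fun i => f i (b i)) := by
        simp_rw [fun f : Fin n → X → Y =>
          sum_sourceProb_mul_comp_eval (p0 := p0) hW x k fun b => Φ fun i => f i (b i),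
          Finset.mul_sum]
        rw [Finset.sum_comm]
        simp_rw [mul_left_comm]
    _ = ∑ b : Fin n → X, ∑ y : Fin n → Y, (∏ i, p0 (x i) * W (x i) (b i) * v (b i) (y i)) *
          Φ y := by
        simp_rw [fun b : Fin n → X => sum_prod_prod_mul_comp_eval (fun _ : Fin n => hv) b Φ,
          Finset.mul_sum, Finset.prod_mul_distrib, mul_assoc]
    _ = ∑ y : Fin n → Y, (∏ i, ∑ b, p0 (x i) * W (x i) b * v b (y i)) * Φ y := by
        rw [Finset.sum_comm]
        simp_rw [Fintype.prod_sum, Finset.sum_mul]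
    _ = ∑ y : Fin n → Y, (∏ i, jointLaw p0 q (x i, y i)) * Φ y := by
        simp_rw [hvq, jointLaw]

variable [DecidableEq Y]

theorem sum_prod_mul_meanSqDist (hW : ∀ x, ∑ b, W x b = 1) (hv : ∀ b, ∑ y, v b y = 1)
    (hvq : ∀ x y, ∑ b, p0 x * W x b * v b y = p0 x * q x y) (k : Fin n → Fin L) :
    ∑ f : Fin n → X → Y, (∏ i, ∏ b, v b (f i b)) *
        meanSqDist p0 W q (fun (xh : Fin L → Fin n → X) i => f i (xh (k i) i))
      = ∑ z : Fin n → X × Y, (∏ i, jointLaw p0 q (z i)) *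
          sqDist (empiricalDist z) (jointLaw p0 q) := by
  calc ∑ f : Fin n → X → Y, (∏ i, ∏ b, v b (f i b)) *
        meanSqDist p0 W q (fun (xh : Fin L → Fin n → X) i => f i (xh (k i) i))
      = ∑ x : Fin n → X, ∑ f : Fin n → X → Y, (∏ i, ∏ b, v b (f i b)) *
          ∑ xh : Fin L → Fin n → X, sourceProb p0 W x xh *
            sqDist (jointType x fun i => f i (xh (k i) i)) (jointLaw p0 q) := by
        simp_rw [meanSqDist, Finset.mul_sum]
        rw [Finset.sum_comm]
    _ = ∑ x : Fin n → X, ∑ y : Fin n → Y, (∏ i, jointLaw p0 q (x i, y i)) *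
          sqDist (jointType x y) (jointLaw p0 q) :=
        Finset.sum_congr rfl fun x _ => sum_prod_mul_sum_sourceProb_mul hW hv hvq x k fun y =>
          sqDist (jointType x y) (jointLaw p0 q)
    _ = ∑ z : Fin n → X × Y, (∏ i, jointLaw p0 q (z i)) *
          sqDist (empiricalDist z) (jointLaw p0 q) := by
        rw [← Fintype.sum_prod_type']
        exact (Fintype.sum_equiv (Equiv.arrowProdEquivProdArrow (Fin n) (fun _ => X) fun _ => Y)
          _ _ fun _ => rfl).symm

theorem exists_meanSqDist_le (hp0 : ∑ x, p0 x = 1) (hW : ∀ x, ∑ b, W x b = 1)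
    (hv : IsCondPMF v) (hvq : ∀ x y, ∑ b, p0 x * W x b * v b y = p0 x * q x y) (hn : n ≠ 0)
    (k : Fin n → Fin L) :
    ∃ f : Fin n → X → Y,
      meanSqDist p0 W q (fun (xh : Fin L → Fin n → X) i => f i (xh (k i) i)) ≤ 1 / n := by
  obtain ⟨f, hf⟩ := exists_le_sum_mul_of_mem_stdSimplex
    (prod_mem_stdSimplex fun _ : Fin n => prod_mem_stdSimplex hv)
    fun f => meanSqDist p0 W q fun (xh : Fin L → Fin n → X) i => f i (xh (k i) i)
  refine ⟨f, hf.trans ?_⟩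
  rw [sum_prod_mul_meanSqDist hW (fun b => (hv b).2) hvq]
  exact sum_prod_mul_sqDist_empiricalDist_le (sum_jointLaw hp0 hW (fun b => (hv b).2) hvq) hn

end Relay

section Codes

variable {X Y : Type*} [Fintype X]

/-- Agent `l` forwards uncoded the symbols it observes at the times `i` with `(j i).1 = l`, and
`f i` turns the symbol forwarded for time `i` into the action. -/
theorem exists_code_output_eq [Nonempty X] {n L m : ℕ} {R : ℝ}
    (hm : Fintype.card X ^ m ≤ numMessages n R) (j : Fin n ↪ Fin L × Fin m)
    (f : Fin n → X → Y) :
    ∃ c : Code X Y L n (fun _ => R), c.output = fun xh i => f i (xh (j i).1 i) := by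
  classical
  obtain ⟨e⟩ : Nonempty ((Fin m → X) ↪ Fin (numMessages n R)) := by
    rw [Function.Embedding.nonempty_iff_card_le]
    simpa using hm
  let block (l : Fin L) (z : Fin n → X) : Fin m → X := fun t =>
    Function.extend j z (fun _ => Classical.arbitrary X) (l, t)
  refine ⟨⟨fun l z => e (block l z), fun μ i => f i (Function.invFun e (μ (j i).1) (j i).2)⟩, ?_⟩
  funext xh i
  simp only [Code.output, Function.leftInverse_invFun e.injective _, block, Prod.mk.eta,
    j.injective.extend_apply]

theorem exists_card_pow_le_numMessages (K : ℕ) {R : ℝ} (hR : 0 < R) :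
    ∃ s : ℕ, 0 < s ∧ ∀ n : ℕ, K ^ (n / s) ≤ numMessages n R := by
  have one_lt : (1 : ℝ) < 2 ^ R := Real.one_lt_rpow one_lt_two hR
  obtain ⟨t, ht⟩ := pow_unbounded_of_one_lt (K : ℝ) one_lt
  refine ⟨t + 1, t.succ_pos, fun n => Nat.le_floor ?_⟩
  have hK : (K : ℝ) ≤ (2 ^ R) ^ (t + 1) := ht.le.trans (pow_le_pow_right₀ one_lt.le t.le_succ)
  calc ((K ^ (n / (t + 1)) : ℕ) : ℝ) = (K : ℝ) ^ (n / (t + 1)) := Nat.cast_pow _ _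
    _ ≤ ((2 ^ R) ^ (t + 1)) ^ (n / (t + 1)) := pow_le_pow_left₀ K.cast_nonneg hK _
    _ = (2 ^ R) ^ ((t + 1) * (n / (t + 1))) := (pow_mul _ _ _).symm
    _ ≤ (2 ^ R) ^ n := pow_le_pow_right₀ one_lt.le (Nat.mul_div_le n (t + 1))
    _ = 2 ^ ((n : ℝ) * R) := by rw [mul_comm, Real.rpow_mul zero_le_two, Real.rpow_natCast]

theorem le_mul_div_of_two_mul_le {n L s : ℕ} (hs : 0 < s) (hn : s ≤ n) (hL : 2 * s ≤ L) :
    n ≤ L * (n / s) := by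
  have one_le : 1 ≤ n / s := Nat.div_pos hn hs
  calc n ≤ s * (n / s + 1) := (Nat.lt_mul_div_succ n hs).le
    _ ≤ 2 * s * (n / s) := by nlinarith
    _ ≤ L * (n / s) := Nat.mul_le_mul_right _ hL

end Codes

section Achievability

theorem sourceProb_nonneg {X : Type*} {p0 : X → ℝ} {W : X → X → ℝ} (hp0 : ∀ x, 0 ≤ p0 x)
    (hW : ∀ x b, 0 ≤ W x b) {L n : ℕ} (x : Fin n → X) (xh : Fin L → Fin n → X) :
    0 ≤ sourceProb p0 W x xh :=
  Finset.prod_nonneg fun _ _ => mul_nonneg (hp0 _) (Finset.prod_nonneg fun _ _ => hW _ _)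


variable {X Y : Type*} [Fintype X] [DecidableEq X] [Fintype Y] [DecidableEq Y]
  {p0 : X → ℝ} {W : X → X → ℝ} {q v : X → Y → ℝ}

theorem deviationProb_le (hp0 : ∀ x, 0 ≤ p0 x) (hW : ∀ x b, 0 ≤ W x b) {n L : ℕ}
    {R : Fin L → ℝ} (c : Code X Y L n R) {ε : ℝ} (hε : 0 < ε) :
    deviationProb p0 W q c ε
      ≤ Fintype.card (X × Y) / (4 * ε ^ 2) * meanSqDist p0 W q c.output := by
  simp_rw [deviationProb, meanSqDist, Finset.mul_sum]
  refine Finset.sum_le_sum fun x _ => Finset.sum_le_sum fun xh _ => ?_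
  have hP := sourceProb_nonneg hp0 hW x xh
  set D := sqDist (jointType x (c.output xh)) (jointLaw p0 q)
  have hD : 0 ≤ D := sqDist_nonneg _ _
  split_ifs with h
  · have large : ε ^ 2 ≤ Fintype.card (X × Y) / 4 * D :=
      (pow_le_pow_left₀ hε.le h.le 2).trans (sq_tvDist_le _ _)
    calc sourceProb p0 W x xh
        ≤ sourceProb p0 W x xh * (Fintype.card (X × Y) / 4 * D / ε ^ 2) :=
          le_mul_of_one_le_right hP ((one_le_div (by positivity)).2 large)
      _ = Fintype.card (X × Y) / (4 * ε ^ 2) * (sourceProb p0 W x xh * D) := by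
          field_simp
  · positivity

theorem exists_code_deviationProb_le [Nonempty X] (hp0 : p0 ∈ stdSimplex ℝ X)
    (hW : IsCondPMF W) (hv : IsCondPMF v)
    (hvq : ∀ x y, ∑ b, p0 x * W x b * v b y = p0 x * q x y) {n L m : ℕ} {R : ℝ}
    (hm : Fintype.card X ^ m ≤ numMessages n R) (hn : n ≠ 0) (hnL : n ≤ L * m) :
    ∃ c : Code X Y L n (fun _ => R), ∀ ε > 0,
      deviationProb p0 W q c ε ≤ Fintype.card (X × Y) / (4 * ε ^ 2) * (1 / n) := by
  obtain ⟨j⟩ : Nonempty (Fin n ↪ Fin L × Fin m) := by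
    rw [Function.Embedding.nonempty_iff_card_le]
    simpa using hnL
  obtain ⟨f, hf⟩ := exists_meanSqDist_le hp0.2 (fun x => (hW x).2) hv hvq hn fun i => (j i).1
  obtain ⟨c, hc⟩ := exists_code_output_eq hm j f
  refine ⟨c, fun ε hε => (deviationProb_le hp0.1 (fun x => (hW x).1) c hε).trans ?_⟩
  rw [hc]
  gcongr

theorem achievable_of_eventually_prod {R : ℝ} (c : ∀ n L : ℕ, Code X Y L n fun _ => R)
    (hc : ∀ ε > 0, ∀ δ > 0, ∀ᶠ a : ℕ × ℕ in atTop ×ˢ atTop,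
      deviationProb p0 W q (c a.1 a.2) ε < δ) :
    Achievable p0 W R q :=
  ⟨c, fun ε hε δ hδ => (hc ε hε δ hδ).curry,
    fun ε hε δ hδ => (eventually_swap_iff.1 (hc ε hε δ hδ)).curry⟩

theorem achievable_of_pos [Nonempty X] [Nonempty Y] (hp0 : p0 ∈ stdSimplex ℝ X)
    (hW : IsCondPMF W) (hv : IsCondPMF v)
    (hvq : ∀ x y, ∑ b, p0 x * W x b * v b y = p0 x * q x y) {R : ℝ} (hR : 0 < R) :
    Achievable p0 W R q := by
  obtain ⟨s, hs, card_le⟩ := exists_card_pow_le_numMessages (Fintype.card X) hR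
  have : ∀ n L : ℕ, Nonempty (Code X Y L n fun _ => R) := fun n L =>
    have : NeZero (numMessages n R) :=
      ⟨((pow_pos Fintype.card_pos _).trans_le (card_le n)).ne'⟩
    ⟨⟨fun _ _ => 0, fun _ _ => Classical.arbitrary Y⟩⟩
  have good : ∀ n L : ℕ, s ≤ n → 2 * s ≤ L → ∃ c : Code X Y L n (fun _ => R), ∀ ε > 0,
      deviationProb p0 W q c ε ≤ Fintype.card (X × Y) / (4 * ε ^ 2) * (1 / n) := fun n L hn hL =>
    exists_code_deviationProb_le hp0 hW hv hvq (card_le n) (hs.trans_le hn).ne'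
      (le_mul_div_of_two_mul_le hs hn hL)
  choose! c hc using good
  refine achievable_of_eventually_prod c fun ε hε δ hδ => ?_
  have small : ∀ᶠ n : ℕ in atTop,
      (Fintype.card (X × Y) : ℝ) / (4 * ε ^ 2) * (1 / n) < δ := by
    have := (tendsto_one_div_atTop_nhds_zero_nat (𝕜 := ℝ)).const_mul
      ((Fintype.card (X × Y) : ℝ) / (4 * ε ^ 2))
    rw [mul_zero] at this
    exact this.eventually_lt_const hδ
  filter_upwards [(small.and (eventually_ge_atTop s)).prod_mk (eventually_ge_atTop (2 * s))]
    with a ⟨⟨hδ, hn⟩, hL⟩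
  exact (hc a.1 a.2 hn hL ε hε).trans_lt hδ

theorem mem_capacityRegion_of_forall_gt (hq : IsCondPMF q) {R : ℝ}
    (h : ∀ R' > R, Achievable p0 W R' q) : (R, q) ∈ capacityRegion Y p0 W := by
  have hlim : Tendsto (fun R' => (R', q)) (𝓝[>] R) (𝓝 (R, q)) :=
    (tendsto_id.mono_left nhdsWithin_le_nhds).prodMk_nhds tendsto_const_nhds
  exact mem_closure_of_tendsto hlim <| eventually_mem_nhdsWithin.mono fun R' hR' => ⟨hq, h R' hR'⟩

end Achievability

end Coordination

theorem theorem2_general {X Y : Type*} [Fintype X] [DecidableEq X] [Fintype Y] [DecidableEq Y]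
    {p0 : X → ℝ} {W : X → X → ℝ} (hp0 : p0 ∈ stdSimplex ℝ X) (hW : Coordination.IsCondPMF W)
    {q : X → Y → ℝ} (hq : Coordination.IsCondPMF q) {p : X → X → Y → ℝ}
    (hp : Coordination.IsJointPMF p0 W q p) (hM : Coordination.IsMarkovChain p) {R : ℝ}
    (hR : 0 ≤ R) : (R, q) ∈ Coordination.capacityRegion Y p0 W := by
  obtain ⟨hp_nonneg, hpW, hpq⟩ := hp
  have : Nonempty X := Coordination.nonempty_of_mem_stdSimplex hp0
  have : Nonempty Y := Coordination.nonempty_of_mem_stdSimplex (hq (Classical.arbitrary X))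
  obtain ⟨v, hv, hpv⟩ := hM.exists_channel hp_nonneg
  have hvq : ∀ x y, ∑ b, p0 x * W x b * v b y = p0 x * q x y := fun x y => by
    simp_rw [← hpq, ← hpW, ← hpv]
  exact Coordination.mem_capacityRegion_of_forall_gt hq fun R' hR' =>
    Coordination.achievable_of_pos hp0 hW hv hvq (hR.trans_lt hR')

theorem theorem2 {X Y : Type*} [Fintype X] [DecidableEq X] [Fintype Y] [DecidableEq Y]
    (p0 : X → ℝ) (W : X → X → ℝ) (hp0 : p0 ∈ stdSimplex ℝ X)
    (hW : Coordination.IsCondPMF W) :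
    closure (Coordination.innerRegion Y p0 W) ⊆ Coordination.capacityRegion Y p0 W :=
  closure_minimal (fun _ ⟨hq, _, hp, hM, hI⟩ => theorem2_general hp0 hW hq hp hM
    ((Coordination.condMutualInfo_nonneg hp.1).trans hI)) isClosed_closure
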